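/- Let $\mathbb F=\mathbb F_q$ be a finite field. *Definitions.* A matroid on a finite set $X$ is given by a rank function $r:2^X\to\mathbb N_0$ with $r(A)\le|A|$, $r$ monotone, and $r(A\cup B)+r(A\cap B)\le r(A)+r(B)$; it is representable over a field $K$ if there is a matrix over $K$ with columns indexed by $X$ such that $r(A)$ is the rank of the submatrix of the columns in $A$, for all $A\subseteq X$. A $q$-polymatroid on a finite-dimensional $\mathbb F$-space $E$ is given by a map $\rho$ from the subspaces of $E$ to $\mathbb Q_{\ge0}$ with $\rho(V)\le\dim V$, $\rho$ monotone, and $\rho(V+W)+\rho(V\cap W)\le\rho(V)+\rho(W)$; it is a $q$-matroid if $\rho$ takes values in $\mathbb N_0$. Two $q$-polymatroids are equivalent if an $\mathbb F$-isomorphism of the ground spaces carries one rank function to the other. For an $\mathbb F$-linear code $\mathcal C\le\mathbb F^{n\times m}$, the column $q$-polymatroid $\mathcal M_{\rm c}(\mathcal C)$ on $\mathbb F^n$ has rank function $\rho_{\rm c}(V)=\frac1m\big(\dim\mathcal C-\dim\{M\in\mathcal C:\operatorname{colsp}(M)\le V^\perp\}\big)$, where $V^\perp$ is taken with respect to the standard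 dot product. The code $\mathcal C$ is right $\mathbb F_{q^m}$-linear if, for some $X\in\mathrm{GL}_m(\mathbb F)$, the code $\mathcal CX$ is invariant under right multiplication by the companion matrix (ones on the superdiagonal, last row $f_0,\dots,f_{m-1}$) of the minimal polynomial $x^m-\sum_i f_ix^i$ over $\mathbb F$ of a primitive element of $\mathbb F_{q^m}$. A $q$-matroid on an $n$-dimensional space is $\mathbb F_{q^m}$-representable if it is equivalent to $\mathcal M_{\rm c}(\mathcal C)$ for some right $\mathbb F_{q^m}$-linear code $\mathcal C\le\mathbb F^{n\times m}$. Let $1\le k\le n$ and let $\mathcal A$ be a collection of $k$-subsets of $[n]$ with $|A\cap B|\le k-2$ for distinct $A,B\in\mathcal A$. Let $M_{[n],\mathcal A}$ be the matroid on $[n]$ with $r(X)=k-1$ if $X\in\mathcal A$ and $r(X)=\min\{|X|,k\}$ otherwise. For a basis $b=(b_1,\dots,b_n)$ of $\mathbb F^n$ put $\mathcal S=\{\langle b_i: i\in A\rangle: A\in\mathcal A\}$, and let $\mathcal M_{n,\mathbb F,\mathcal S}$ be the $q$-matroid on $\mathbb F^n$ with $\rho(V)=k-1$ if $V\in\mathcal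 S$ and $\rho(V)=\min\{\dim V,k\}$ otherwise. For a $q$-matroid $\mathcal M=(\mathbb F^n,\rho)$ let $M(\mathcal M,b)$ be the matroid on $[n]$ with rank function $A\mapsto\rho(\langle b_i:i\in A\rangle)$. *Statement.* Each of the following holds for every basis $b$ of $\mathbb F^n$. (a) Vámos matroid. Let $n=8$, $k=4$, $\mathcal A=\{1234,1456,2356,1478,2378\}$. Then $V_8=M_{[8],\mathcal A}$ is not representable over any field, $M(\mathcal M_{8,\mathbb F,\mathcal S},b)=V_8$, and $\mathcal M_{8,\mathbb F,\mathcal S}$ is not $\mathbb F_{q^m}$-representable for any $m\ge1$. The same three assertions hold for the non-Pappus matroid, $n=9$, $k=3$, $\mathcal A=\{123,456,157,247,168,348,269,359\}$. (b) Fano matroid. Let $n=7$, $k=3$, $\mathcal A=\{124,235,347,157,267,456,136\}$. Then $F_7=M_{[7],\mathcal A}$ is not representable over any field of odd characteristic, $M(\mathcal M_{7,\mathbb F,\mathcal S},b)=F_7$, and if $q$ is odd, then $\mathcal M_{7,\mathbb F,\mathcal S}$ is not $\mathbb F_{q^m}$-representable for any $m\ge1$. (c) Non-Fano matroid. Let $\mathcal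 A'$ be obtained from the collection $\mathcal A$ in (b) by omitting any one of its members, and let $\mathcal S'$ be the corresponding collection of subspaces. Then $F_7^-=M_{[7],\mathcal A'}$ is not representable over any field of characteristic $2$, $M(\mathcal M_{7,\mathbb F,\mathcal S'},b)=F_7^-$, and if $q$ is even, then $\mathcal M_{7,\mathbb F,\mathcal S'}$ is not $\mathbb F_{q^m}$-representable for any $m\ge1$. In particular, over every finite field $\mathbb F_q$ there is a $q$-matroid that is not $\mathbb F_{q^m}$-representable for any $m\ge1$; so the question of Jurrius and Pellikaan whether every $q$-matroid is representable has a negative answer. -/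

import Mathlib

universe u v w

/-! ### Classical matroids given by a rank function -/

/-- A matroid on the finite set `ι`, given by its rank function: (R1) `0 ≤ r A ≤ |A|`,
(R2) monotonicity, (R3) submodularity. -/
structure MatroidRank (ι : Type*) [DecidableEq ι] where
  r : Finset ι → ℕ
  r_le_card : ∀ A, r A ≤ A.card
  r_mono : ∀ A B, A ⊆ B → r A ≤ r B
  r_submod : ∀ A B, r (A ∪ B) + r (A ∩ B) ≤ r A + r B

namespace MatroidRank

variable {ι : Type*} [DecidableEq ι] (R : MatroidRank ι)

theorem r_empty : R.r ∅ = 0 := by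
  have := R.r_le_card ∅
  simpa using this

theorem r_union_eq (I S : Finset ι) (h : ∀ e ∈ S, R.r (insert e I) = R.r I) :
    R.r (I ∪ S) = R.r I := by
  induction S using Finset.induction_on with
  | empty => simp
  | insert e S he ih =>
    have ih' := ih (fun x hx => h x (Finset.mem_insert_of_mem hx))
    have h1 := h e (Finset.mem_insert_self e S)
    have h2 := R.r_submod (I ∪ S) (insert e I)
    have h3 : (I ∪ S) ∪ insert e I = I ∪ insert e S := by
      ext x; simp only [Finset.mem_union, Finset.mem_insert]; tauto
    have h4 : I ⊆ (I ∪ S) ∩ insert e I := by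
      intro x hx; simp [hx]
    have h5 := R.r_mono _ _ h4
    have h6 : R.r I ≤ R.r (I ∪ insert e S) := R.r_mono _ _ Finset.subset_union_left
    rw [h3] at h2
    omega

theorem indep_subset {I J : Finset ι} (hJ : R.r J = J.card) (hIJ : I ⊆ J) :
    R.r I = I.card := by
  have h1 := R.r_submod I (J \ I)
  have h2 := R.r_le_card (J \ I)
  have h3 := R.r_le_card I
  have h4 := Finset.card_sdiff_add_card_eq_card hIJ
  rw [Finset.union_sdiff_of_subset hIJ] at h1
  omega

theorem r_insert_of_dep {I : Finset ι} (hI : R.r I = I.card) {e : ι} (he : e ∉ I)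
    (hd : R.r (insert e I) ≠ (insert e I).card) : R.r (insert e I) = R.r I := by
  have h1 := R.r_le_card (insert e I)
  have h2 := R.r_mono I (insert e I) (Finset.subset_insert e I)
  rw [Finset.card_insert_of_notMem he] at h1 hd
  omega

theorem indep_aug {I J : Finset ι} (hI : R.r I = I.card) (hJ : R.r J = J.card)
    (hlt : I.card < J.card) : ∃ e ∈ J, e ∉ I ∧ R.r (insert e I) = (insert e I).card := by
  by_contra! hcon
  have h1 : R.r (I ∪ J) = R.r I := by
    refine R.r_union_eq I J fun e he => ?_
    by_cases heI : e ∈ I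
    · rw [Finset.insert_eq_of_mem heI]
    · exact R.r_insert_of_dep hI heI (hcon e he heI)
  have h2 : R.r J ≤ R.r (I ∪ J) := R.r_mono _ _ Finset.subset_union_right
  omega

/-- The matroid with ground set `ι` and rank function `r`: a set `I` is independent
iff `r I = |I|`. -/
def toMatroid : Matroid ι :=
  (IndepMatroid.ofFinset Set.univ (fun I => R.r I = I.card) R.r_empty
    (fun _ _ hJ hIJ => R.indep_subset hJ hIJ) (fun _ _ hI hJ hlt => R.indep_aug hI hJ hlt)
    (fun _ _ => Set.subset_univ _)).matroid

theorem toMatroid_E : R.toMatroid.E = Set.univ := rfl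

theorem toMatroid_indep (I : Finset ι) : R.toMatroid.Indep (I : Set ι) ↔ R.r I = I.card :=
  IndepMatroid.matroid_indep_iff.trans (IndepMatroid.ofFinset_indep ..)

/-- `toMatroid` has the prescribed rank function. -/
theorem toMatroid_eRk (A : Finset ι) : R.toMatroid.eRk (A : Set ι) = R.r A := by
  obtain ⟨I, hI⟩ := R.toMatroid.exists_isBasis (A : Set ι)
    (by rw [toMatroid_E]; exact Set.subset_univ _)
  have hfin : I.Finite := A.finite_toSet.subset hI.subset
  obtain ⟨I, rfl⟩ := hfin.exists_finset_coe
  rw [← hI.encard_eq_eRk, Set.encard_coe_eq_coe_finsetCard]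
  have hind : R.r I = I.card := (R.toMatroid_indep I).1 hI.indep
  have hsub : I ⊆ A := by exact_mod_cast hI.subset
  have h1 : R.r (I ∪ A) = R.r I := by
    refine R.r_union_eq I A fun e he => ?_
    by_cases heI : e ∈ I
    · rw [Finset.insert_eq_of_mem heI]
    · refine R.r_insert_of_dep hind heI fun hc => ?_
      have := (R.toMatroid_indep (insert e I)).2 hc
      have h2 := hI.eq_of_subset_indep this (by simp) (by
        intro x hx
        rcases Finset.mem_insert.1 (Finset.mem_coe.1 hx) with rfl | hx
        · exact he
        · exact hsub hx)
      rw [Finset.coe_inj] at h2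
      exact heI (h2 ▸ Finset.mem_insert_self e I)
  rw [Finset.union_eq_right.2 hsub] at h1
  rw [h1, hind]

end MatroidRank

/-- `M` is representable over `K`: there is a matrix over `K` whose columns are indexed by the
elements such that the rank of every set `A` is the rank of the submatrix of columns in `A`. -/
def Matroid.IsRepresentableOver {ι : Type*} (M : Matroid ι) (K : Type*) [Field K] : Prop :=
  ∃ (k : ℕ) (G : Matrix (Fin k) ι K), ∀ A : Finset ι,
    M.eRk (A : Set ι) = ((G.submatrix id (fun a : A => (a : ι))).rank : ℕ∞)

/-- A collection of `k`-subsets, `k ≥ 1`, any two distinct members of which meet in at most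
`k - 2` elements. -/
structure IsPavingSets {ι : Type*} [DecidableEq ι] (k : ℕ) (𝒜 : Finset (Finset ι)) : Prop where
  one_le : 1 ≤ k
  card_eq : ∀ A ∈ 𝒜, A.card = k
  inter_le : ∀ A ∈ 𝒜, ∀ B ∈ 𝒜, A ≠ B → (A ∩ B).card + 2 ≤ k

/-- The rank function with value `k - 1` on the members of `𝒜` and `min |X| k` elsewhere. -/
def pavingRank {ι : Type*} [DecidableEq ι] {k : ℕ} {𝒜 : Finset (Finset ι)}
    (h : IsPavingSets k 𝒜) : MatroidRank ι where
  r X := if X ∈ 𝒜 then k - 1 else min X.card k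
  r_le_card X := by
    have := h.card_eq X
    split_ifs with hX
    · have := this hX; omega
    · omega
  r_mono A B hAB := by
    have hA := h.card_eq A
    have hB := h.card_eq B
    have hle := Finset.card_le_card hAB
    have hk := h.one_le
    split_ifs with h1 h2 h2
    · omega
    · have := hA h1; omega
    · have := hB h2
      have hlt : A.card < B.card := Finset.card_lt_card (hAB.ssubset_of_ne (by
        rintro rfl; exact h1 h2))
      omega
    · omega
  r_submod A B := by
    have hk := h.one_le
    have hadd := Finset.card_union_add_card_inter A B
    have hU : (if A ∪ B ∈ 𝒜 then k - 1 else min (A ∪ B).card k) ≤ min (A ∪ B).card k := by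
      have := h.card_eq (A ∪ B)
      split_ifs with hc
      · have := this hc; omega
      · exact le_rfl
    have hI : (if A ∩ B ∈ 𝒜 then k - 1 else min (A ∩ B).card k) ≤ min (A ∩ B).card k := by
      have := h.card_eq (A ∩ B)
      split_ifs with hc
      · have := this hc; omega
      · exact le_rfl
    by_cases hAB : A ⊆ B
    · rw [Finset.union_eq_right.2 hAB, Finset.inter_eq_left.2 hAB, add_comm]
    by_cases hBA : B ⊆ A
    · rw [Finset.union_eq_left.2 hBA, Finset.inter_eq_right.2 hBA]
    have hlA : (A ∩ B).card < A.card := Finset.card_lt_card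
      (Finset.inter_subset_left.ssubset_of_ne (by rw [Ne, Finset.inter_eq_left]; exact hAB))
    have hlB : (A ∩ B).card < B.card := Finset.card_lt_card
      (Finset.inter_subset_right.ssubset_of_ne (by rw [Ne, Finset.inter_eq_right]; exact hBA))
    refine (add_le_add hU hI).trans ?_
    have hA := h.card_eq A
    have hB := h.card_eq B
    split_ifs with h1 h2 h2
    · have := h.inter_le A h1 B h2 (by rintro rfl; exact hAB subset_rfl)
      have := hA h1; have := hB h2; omega
    · have := hA h1; omega
    · have := hB h2; omega
    · omega

/-- The matroid `M_{ι,𝒜}`: a set `X` has rank `k - 1` if `X ∈ 𝒜` and `min |X| k` otherwise. -/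
def pavingMatroid {ι : Type*} [DecidableEq ι] (k : ℕ) (𝒜 : Finset (Finset ι))
    (h : IsPavingSets k 𝒜) : Matroid ι :=
  (pavingRank h).toMatroid

/-! ### `q`-polymatroids and `q`-matroids -/

/-- A `q`-polymatroid on the `F`-vector space `E`. -/
structure QPolymatroid (F E : Type*) [Field F] [AddCommGroup E] [Module F E] where
  rk : Submodule F E → ℚ
  rk_nonneg : ∀ V, 0 ≤ rk V
  rk_le_finrank : ∀ V, rk V ≤ Module.finrank F V
  rk_mono : ∀ V W, V ≤ W → rk V ≤ rk W
  rk_submod : ∀ V W, rk (V ⊔ W) + rk (V ⊓ W) ≤ rk V + rk W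

/-- A `q`-matroid: a `q`-polymatroid whose rank function takes values in the natural numbers. -/
structure QMatroid (F E : Type*) [Field F] [AddCommGroup E] [Module F E] extends
    QPolymatroid F E where
  rk_nat : ∀ V, ∃ k : ℕ, rk V = k

/-- Two `q`-polymatroids are equivalent if a linear isomorphism of the ground spaces carries
one rank function to the other. -/
def QPolymatroid.Equivalent {F E₁ E₂ : Type*} [Field F] [AddCommGroup E₁] [Module F E₁]
    [AddCommGroup E₂] [Module F E₂] (M₁ : QPolymatroid F E₁) (M₂ : QPolymatroid F E₂) : Prop :=
  ∃ α : E₁ ≃ₗ[F] E₂, ∀ V : Submodule F E₁,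
    M₂.rk (V.map (α : E₁ →ₗ[F] E₂)) = M₁.rk V

theorem span_basis_inf {F E ι : Type*} [Field F] [AddCommGroup E] [Module F E]
    (b : Module.Basis ι F E) (s t : Set ι) :
    Submodule.span F (b '' s) ⊓ Submodule.span F (b '' t) = Submodule.span F (b '' (s ∩ t)) := by
  ext x
  simp only [Submodule.mem_inf, Module.Basis.mem_span_image, Set.subset_inter_iff]

theorem finrank_span_basis {F E ι : Type*} [Field F] [AddCommGroup E] [Module F E]
    (b : Module.Basis ι F E) (A : Finset ι) :
    Module.finrank F (Submodule.span F (b '' (A : Set ι))) = A.card := by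
  classical
  have h := finrank_span_finset_eq_card (R := F) (s := A.image b) (by
    have := (b.linearIndependent.linearIndepOn (s := (A : Set ι))).id_image
    rw [Finset.coe_image]
    exact this)
  rw [Finset.coe_image, Finset.card_image_of_injective _ b.injective] at h
  exact h

/-- The matroid `M(ℳ, b)` induced by a `q`-matroid and a basis `b` of its ground space,
`A ↦ ρ(⟨b_i : i ∈ A⟩)`, with ground set the index set of the basis. -/
noncomputable def QMatroid.inducedRank {F E ι : Type*} [Field F] [AddCommGroup E] [Module F E]
    [DecidableEq ι] (M : QMatroid F E) (b : Module.Basis ι F E) : MatroidRank ι where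
  r A := ⌊M.rk (Submodule.span F (b '' (A : Set ι)))⌋₊
  r_le_card A := by
    have h := M.rk_le_finrank (Submodule.span F (b '' (A : Set ι)))
    rw [finrank_span_basis] at h
    exact Nat.floor_le_of_le h
  r_mono A B hAB := Nat.floor_le_floor (M.rk_mono _ _ (Submodule.span_mono
    (Set.image_mono (by exact_mod_cast hAB))))
  r_submod A B := by
    have h := M.rk_submod (Submodule.span F (b '' (A : Set ι)))
      (Submodule.span F (b '' (B : Set ι)))
    rw [span_basis_inf, ← Submodule.span_union, ← Set.image_union, ← Finset.coe_union,
      ← Finset.coe_inter] at h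
    obtain ⟨k₁, h₁⟩ := M.rk_nat (Submodule.span F (b '' ((A ∪ B : Finset ι) : Set ι)))
    obtain ⟨k₂, h₂⟩ := M.rk_nat (Submodule.span F (b '' ((A ∩ B : Finset ι) : Set ι)))
    obtain ⟨k₃, h₃⟩ := M.rk_nat (Submodule.span F (b '' (A : Set ι)))
    obtain ⟨k₄, h₄⟩ := M.rk_nat (Submodule.span F (b '' (B : Set ι)))
    rw [h₁, h₂, h₃, h₄] at h ⊢
    simp only [Nat.floor_natCast]
    exact_mod_cast h

/-- The matroid with rank function `QMatroid.inducedRank`. -/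
noncomputable def QMatroid.inducedMatroid {F E ι : Type*} [Field F] [AddCommGroup E] [Module F E]
    [DecidableEq ι] (M : QMatroid F E) (b : Module.Basis ι F E) : Matroid ι :=
  (M.inducedRank b).toMatroid

/-- A collection of `k`-spaces, `k ≥ 1`, any two distinct members of which meet in a space of
dimension at most `k - 2`. -/
structure IsPavingSpaces {F E : Type*} [Field F] [AddCommGroup E] [Module F E] (k : ℕ)
    (S : Set (Submodule F E)) : Prop where
  one_le : 1 ≤ k
  finrank_eq : ∀ V ∈ S, Module.finrank F V = k
  inf_le : ∀ V ∈ S, ∀ W ∈ S, V ≠ W → Module.finrank F (V ⊓ W : Submodule F E) + 2 ≤ k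

open Classical in
/-- The function `V ↦ k - 1` if `V ∈ S`, and `V ↦ min (dim V) k` otherwise. -/
noncomputable def qPavingRank {F E : Type*} [Field F] [AddCommGroup E] [Module F E] (k : ℕ)
    (S : Set (Submodule F E)) (V : Submodule F E) : ℕ :=
  if V ∈ S then k - 1 else min (Module.finrank F V) k

section

variable {F E : Type*} [Field F] [AddCommGroup E] [Module F E] {k : ℕ} {S : Set (Submodule F E)}

theorem qPavingRank_le (h : IsPavingSpaces k S) (V : Submodule F E) :
    qPavingRank k S V ≤ min (Module.finrank F V) k := by
  have := h.finrank_eq V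
  unfold qPavingRank
  split_ifs with hV
  · have := this hV; omega
  · exact le_rfl

theorem qPavingRank_mono [FiniteDimensional F E] (h : IsPavingSpaces k S) {V W : Submodule F E}
    (hVW : V ≤ W) : qPavingRank k S V ≤ qPavingRank k S W := by
  have hV := h.finrank_eq V
  have hW := h.finrank_eq W
  have hle := Submodule.finrank_mono hVW
  have hk := h.one_le
  unfold qPavingRank
  split_ifs with h1 h2 h2
  · omega
  · have := hV h1; omega
  · have := hW h2
    have hlt : Module.finrank F V < Module.finrank F W :=
      Submodule.finrank_lt_finrank_of_lt (lt_of_le_of_ne hVW (by rintro rfl; exact h1 h2))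
    omega
  · omega

theorem qPavingRank_submod [FiniteDimensional F E] (h : IsPavingSpaces k S)
    (V W : Submodule F E) :
    qPavingRank k S (V ⊔ W) + qPavingRank k S (V ⊓ W) ≤ qPavingRank k S V + qPavingRank k S W := by
  have hk := h.one_le
  have hadd := Submodule.finrank_sup_add_finrank_inf_eq V W
  by_cases hVW : V ≤ W
  · rw [sup_eq_right.2 hVW, inf_eq_left.2 hVW, add_comm]
  by_cases hWV : W ≤ V
  · rw [sup_eq_left.2 hWV, inf_eq_right.2 hWV]
  have hlV : Module.finrank F (V ⊓ W : Submodule F E) < Module.finrank F V :=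
    Submodule.finrank_lt_finrank_of_lt (inf_lt_left.2 hVW)
  have hlW : Module.finrank F (V ⊓ W : Submodule F E) < Module.finrank F W :=
    Submodule.finrank_lt_finrank_of_lt (inf_lt_right.2 hWV)
  refine (add_le_add (qPavingRank_le h _) (qPavingRank_le h _)).trans ?_
  have hV := h.finrank_eq V
  have hW := h.finrank_eq W
  unfold qPavingRank
  split_ifs with h1 h2 h2
  · have := h.inf_le V h1 W h2 (by rintro rfl; exact hVW le_rfl)
    have := hV h1; have := hW h2; omega
  · have := hV h1; omega
  · have := hW h2; omega
  · omega

/-- The `q`-matroid `ℳ_{n,F,S}` (for `E = F^n`): a subspace `V` has rank `k - 1` if `V ∈ S` and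
`min (dim V) k` otherwise. -/
noncomputable def pavingQMatroid [FiniteDimensional F E] (k : ℕ) (S : Set (Submodule F E))
    (h : IsPavingSpaces k S) : QMatroid F E where
  rk V := qPavingRank k S V
  rk_nonneg _ := Nat.cast_nonneg _
  rk_le_finrank V := by exact_mod_cast (qPavingRank_le h V).trans (min_le_left _ _)
  rk_mono _ _ hVW := by exact_mod_cast qPavingRank_mono h hVW
  rk_submod V W := by exact_mod_cast qPavingRank_submod h V W
  rk_nat V := ⟨qPavingRank k S V, rfl⟩

end

/-- The collection of the spaces `⟨b_i : i ∈ A⟩`, `A ∈ 𝒜`. -/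
def spanFamily {F E ι : Type*} [Field F] [AddCommGroup E] [Module F E]
    (b : Module.Basis ι F E) (𝒜 : Finset (Finset ι)) : Set (Submodule F E) :=
  {V | ∃ A ∈ 𝒜, V = Submodule.span F (b '' (A : Set ι))}

theorem IsPavingSets.spanFamily {F E ι : Type*} [Field F] [AddCommGroup E] [Module F E]
    [DecidableEq ι] (b : Module.Basis ι F E) {k : ℕ} {𝒜 : Finset (Finset ι)}
    (h : IsPavingSets k 𝒜) : IsPavingSpaces k (spanFamily b 𝒜) where
  one_le := h.one_le
  finrank_eq := by
    rintro _ ⟨A, hA, rfl⟩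
    rw [finrank_span_basis, h.card_eq A hA]
  inf_le := by
    rintro _ ⟨A, hA, rfl⟩ _ ⟨B, hB, rfl⟩ hne
    rw [span_basis_inf, ← Finset.coe_inter, finrank_span_basis]
    exact h.inter_le A hA B hB (by rintro rfl; exact hne rfl)

/-! ### Rank-metric codes and representability of `q`-matroids -/

section Codes

variable {F : Type*} [Field F] {n m : ℕ}

/-- The orthogonal space with respect to the standard dot product. -/
def dotPerp (V : Submodule F (Fin n → F)) : Submodule F (Fin n → F) where
  carrier := {w | ∀ v ∈ V, v ⬝ᵥ w = 0}
  add_mem' := by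
    intro x y hx hy v hv
    rw [dotProduct_add, hx v hv, hy v hv, add_zero]
  zero_mem' := fun v _ => dotProduct_zero v
  smul_mem' := by
    intro c x hx v hv
    rw [dotProduct_smul, hx v hv, smul_zero]

/-- The shortening `C(V, c)`: the matrices in `C` whose column space lies in `V`. -/
def shortening (C : Submodule F (Matrix (Fin n) (Fin m) F)) (V : Submodule F (Fin n → F)) :
    Submodule F (Matrix (Fin n) (Fin m) F) where
  carrier := {M | M ∈ C ∧ LinearMap.range M.mulVecLin ≤ V}
  add_mem' := by
    rintro M N ⟨hM, hM'⟩ ⟨hN, hN'⟩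
    refine ⟨C.add_mem hM hN, ?_⟩
    rintro _ ⟨x, rfl⟩
    rw [Matrix.mulVecLin_apply, Matrix.add_mulVec]
    exact V.add_mem (hM' ⟨x, rfl⟩) (hN' ⟨x, rfl⟩)
  zero_mem' := by
    refine ⟨C.zero_mem, ?_⟩
    rintro _ ⟨x, rfl⟩
    simp
  smul_mem' := by
    rintro c M ⟨hM, hM'⟩
    refine ⟨C.smul_mem c hM, ?_⟩
    rintro _ ⟨x, rfl⟩
    rw [Matrix.mulVecLin_apply, Matrix.smul_mulVec]
    exact V.smul_mem c (hM' ⟨x, rfl⟩)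

theorem mem_shortening_perp (C : Submodule F (Matrix (Fin n) (Fin m) F))
    (V : Submodule F (Fin n → F)) (M : Matrix (Fin n) (Fin m) F) :
    M ∈ shortening C (dotPerp V) ↔ M ∈ C ∧ ∀ v ∈ V, Matrix.vecMul v M = 0 := by
  refine and_congr_right fun _ => ⟨fun h v hv => ?_, fun h => ?_⟩
  · refine dotProduct_eq_zero _ fun x => ?_
    rw [← Matrix.dotProduct_mulVec]
    exact h ⟨x, rfl⟩ v hv
  · rintro _ ⟨x, rfl⟩ v hv
    rw [Matrix.mulVecLin_apply, Matrix.dotProduct_mulVec, h v hv, zero_dotProduct]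

theorem shortening_le (C : Submodule F (Matrix (Fin n) (Fin m) F)) (V : Submodule F (Fin n → F)) :
    shortening C V ≤ C := fun _ h => h.1

theorem shortening_perp_anti (C : Submodule F (Matrix (Fin n) (Fin m) F))
    {V W : Submodule F (Fin n → F)} (h : V ≤ W) :
    shortening C (dotPerp W) ≤ shortening C (dotPerp V) := by
  intro M hM
  rw [mem_shortening_perp] at hM ⊢
  exact ⟨hM.1, fun v hv => hM.2 v (h hv)⟩

theorem finrank_le_shortening_perp (C : Submodule F (Matrix (Fin n) (Fin m) F))
    (V : Submodule F (Fin n → F)) :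
    Module.finrank F C ≤
      Module.finrank F V * m + Module.finrank F (shortening C (dotPerp V)) := by
  let φ : C →ₗ[F] (V →ₗ[F] (Fin m → F)) :=
    { toFun := fun M => (Matrix.vecMulLinear (M : Matrix (Fin n) (Fin m) F)).comp V.subtype
      map_add' := fun M N => by ext; simp
      map_smul' := fun c M => by ext; simp }
  have h1 := LinearMap.finrank_range_add_finrank_ker φ
  have h2 : Module.finrank F (LinearMap.range φ) ≤ Module.finrank F V * m := by
    refine (Submodule.finrank_le _).trans ?_
    rw [Module.finrank_linearMap, Module.finrank_fin_fun]
  have h3 : Module.finrank F (LinearMap.ker φ) ≤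
      Module.finrank F (shortening C (dotPerp V)) := by
    let ψ : LinearMap.ker φ →ₗ[F] shortening C (dotPerp V) :=
      LinearMap.codRestrict _ (C.subtype.comp (LinearMap.ker φ).subtype) (fun M => by
        rw [mem_shortening_perp]
        refine ⟨M.1.2, fun v hv => ?_⟩
        exact LinearMap.congr_fun (LinearMap.mem_ker.1 M.2) ⟨v, hv⟩)
    refine LinearMap.finrank_le_finrank_of_injective (f := ψ) fun M N hMN => ?_
    have h := congrArg (Subtype.val : _ → Matrix (Fin n) (Fin m) F) hMN
    exact Subtype.ext (Subtype.ext h)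
  omega

/-- The column `q`-polymatroid `ℳ_c(C)` of a rank-metric code `C ≤ F^{n × m}`. -/
noncomputable def columnQPM (C : Submodule F (Matrix (Fin n) (Fin m) F)) :
    QPolymatroid F (Fin n → F) where
  rk V := ((Module.finrank F C : ℚ) - Module.finrank F (shortening C (dotPerp V))) / m
  rk_nonneg V := by
    refine div_nonneg (sub_nonneg.2 ?_) (Nat.cast_nonneg _)
    exact_mod_cast Submodule.finrank_mono (shortening_le C _)
  rk_le_finrank V := by
    refine div_le_of_le_mul₀ (Nat.cast_nonneg _) (Nat.cast_nonneg _) ?_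
    rw [sub_le_iff_le_add]
    exact_mod_cast finrank_le_shortening_perp C V
  rk_mono V W h := by
    refine div_le_div_of_nonneg_right (sub_le_sub_left ?_ _) (Nat.cast_nonneg _)
    exact_mod_cast Submodule.finrank_mono (shortening_perp_anti C h)
  rk_submod V W := by
    rw [← add_div, ← add_div]
    refine div_le_div_of_nonneg_right ?_ (Nat.cast_nonneg _)
    have h1 := Submodule.finrank_sup_add_finrank_inf_eq
      (shortening C (dotPerp V)) (shortening C (dotPerp W))
    have h2 : shortening C (dotPerp V) ⊓ shortening C (dotPerp W) ≤
        shortening C (dotPerp (V ⊔ W)) := by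
      rintro M ⟨hV, hW⟩
      rw [SetLike.mem_coe, mem_shortening_perp] at hV hW
      rw [mem_shortening_perp]
      refine ⟨hV.1, fun v hv => ?_⟩
      obtain ⟨x, hx, y, hy, rfl⟩ := Submodule.mem_sup.1 hv
      rw [Matrix.add_vecMul, hV.2 x hx, hW.2 y hy, add_zero]
    have h3 : shortening C (dotPerp V) ⊔ shortening C (dotPerp W) ≤
        shortening C (dotPerp (V ⊓ W)) :=
      sup_le (shortening_perp_anti C inf_le_left) (shortening_perp_anti C inf_le_right)
    have h2' := Submodule.finrank_mono h2
    have h3' := Submodule.finrank_mono h3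
    have h4 : Module.finrank F (shortening C (dotPerp V)) +
        Module.finrank F (shortening C (dotPerp W)) ≤
        Module.finrank F (shortening C (dotPerp (V ⊔ W))) +
        Module.finrank F (shortening C (dotPerp (V ⊓ W))) := by omega
    have h5 : (Module.finrank F (shortening C (dotPerp V)) : ℚ) +
        Module.finrank F (shortening C (dotPerp W)) ≤
        Module.finrank F (shortening C (dotPerp (V ⊔ W))) +
        Module.finrank F (shortening C (dotPerp (V ⊓ W))) := by exact_mod_cast h4
    linarith

/-- The companion matrix of `f = x^m - ∑ f_i x^i`: ones on the superdiagonal and last row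
`f_0, …, f_{m-1}`. -/
def companionMatrix (m : ℕ) (f : Polynomial F) : Matrix (Fin m) (Fin m) F :=
  Matrix.of fun i j =>
    if (i : ℕ) + 1 = m then -f.coeff j else if (j : ℕ) = i + 1 then 1 else 0

/-- A code `C ≤ F^{n × m}` is right linear over the extension field `K` of degree `m` of `F` if
for some `X ∈ GL_m(F)` the code `C X` is invariant under right multiplication by the companion
matrix of the minimal polynomial of a primitive element `ω` of `K`. -/
def IsRightLinear (K : Type*) [Field K] [Algebra F K]
    (C : Submodule F (Matrix (Fin n) (Fin (Module.finrank F K)) F)) : Prop :=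
  ∃ ω : Kˣ, (∀ x : Kˣ, x ∈ Subgroup.zpowers ω) ∧
    ∃ X : GL (Fin (Module.finrank F K)) F, ∀ M ∈ C, ∃ N ∈ C,
      M * X.val * companionMatrix (Module.finrank F K) (minpoly F (ω : K)) = N * X.val

end Codes

/-- A `q`-matroid is representable over the extension field `K = F_{q^m}` of `F = F_q` if it is
equivalent to the column `q`-polymatroid of a right `K`-linear code in `F^{n × m}`.
(The equivalence forces `n` to be the dimension of the ground space.) -/
def QMatroid.IsRepresentableOver {F E : Type*} [Field F] [AddCommGroup E] [Module F E]
    (M : QMatroid F E) (K : Type*) [Field K] [Algebra F K] : Prop :=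
  ∃ (n : ℕ) (C : Submodule F (Matrix (Fin n) (Fin (Module.finrank F K)) F)),
    IsRightLinear K C ∧ M.toQPolymatroid.Equivalent (columnQPM C)

/-! ### The Vámos, non-Pappus, Fano and non-Fano matroids

Elements are numbered from `0`: the element `i` below is the element `i + 1` of `[n]`. -/

/-- The five exceptional 4-sets `1234, 1456, 2356, 1478, 2378`. -/
def vamosSets : Finset (Finset (Fin 8)) :=
  {{0, 1, 2, 3}, {0, 3, 4, 5}, {1, 2, 4, 5}, {0, 3, 6, 7}, {1, 2, 6, 7}}

set_option maxRecDepth 10000 in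
theorem vamosSets_paving : IsPavingSets 4 vamosSets :=
  ⟨by decide, by decide, by decide⟩

/-- The eight lines `123, 456, 157, 247, 168, 348, 269, 359` of the non-Pappus configuration
(`789` is not a line). -/
def nonPappusLines : Finset (Finset (Fin 9)) :=
  {{0, 1, 2}, {3, 4, 5}, {0, 4, 6}, {1, 3, 6}, {0, 5, 7}, {2, 3, 7}, {1, 5, 8}, {2, 4, 8}}

set_option maxRecDepth 10000 in
theorem nonPappusLines_paving : IsPavingSets 3 nonPappusLines :=
  ⟨by decide, by decide, by decide⟩

/-- The seven lines `124, 235, 347, 157, 267, 456, 136` of the Fano plane. -/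
def fanoLines : Finset (Finset (Fin 7)) :=
  {{0, 1, 3}, {1, 2, 4}, {2, 3, 6}, {0, 4, 6}, {1, 5, 6}, {3, 4, 5}, {0, 2, 5}}

set_option maxRecDepth 10000 in
theorem fanoLines_paving : IsPavingSets 3 fanoLines :=
  ⟨by decide, by decide, by decide⟩

theorem nonFanoLines_paving (L : Finset (Fin 7)) : IsPavingSets 3 (fanoLines.erase L) :=
  ⟨by decide, fun A hA => fanoLines_paving.card_eq A (Finset.mem_of_mem_erase hA),
    fun A hA B hB => fanoLines_paving.inter_le A (Finset.mem_of_mem_erase hA) B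
      (Finset.mem_of_mem_erase hB)⟩

/-- The Vámos matroid `V_8`. -/
def vamosMatroid : Matroid (Fin 8) :=
  pavingMatroid 4 vamosSets vamosSets_paving

/-- The non-Pappus matroid. -/
def nonPappusMatroid : Matroid (Fin 9) :=
  pavingMatroid 3 nonPappusLines nonPappusLines_paving

/-- The Fano matroid `F_7`. -/
def fanoMatroid : Matroid (Fin 7) :=
  pavingMatroid 3 fanoLines fanoLines_paving

/-- The non-Fano matroid `F_7⁻` obtained by omitting the line `L`. -/
def nonFanoMatroid (L : Finset (Fin 7)) : Matroid (Fin 7) :=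
  pavingMatroid 3 (fanoLines.erase L) (nonFanoLines_paving L)

section

variable {F : Type*} [Field F]

/-- The `q`-matroid `ℳ_{8,F,S}` with `S` the spans of the exceptional sets of the Vámos matroid. -/
noncomputable def vamosQMatroid (b : Module.Basis (Fin 8) F (Fin 8 → F)) :
    QMatroid F (Fin 8 → F) :=
  pavingQMatroid 4 (spanFamily b vamosSets) (vamosSets_paving.spanFamily b)

/-- The `q`-matroid `ℳ_{9,F,S}` with `S` the spans of the lines of the non-Pappus matroid. -/
noncomputable def nonPappusQMatroid (b : Module.Basis (Fin 9) F (Fin 9 → F)) :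
    QMatroid F (Fin 9 → F) :=
  pavingQMatroid 3 (spanFamily b nonPappusLines) (nonPappusLines_paving.spanFamily b)

/-- The `q`-matroid `ℳ_{7,F,S}` with `S` the spans of the lines of the Fano plane. -/
noncomputable def fanoQMatroid (b : Module.Basis (Fin 7) F (Fin 7 → F)) :
    QMatroid F (Fin 7 → F) :=
  pavingQMatroid 3 (spanFamily b fanoLines) (fanoLines_paving.spanFamily b)

/-- The `q`-matroid `ℳ_{7,F,S}` with `S` the spans of the lines of the Fano plane other than
`L`. -/
noncomputable def nonFanoQMatroid (L : Finset (Fin 7)) (b : Module.Basis (Fin 7) F (Fin 7 → F)) :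
    QMatroid F (Fin 7 → F) :=
  pavingQMatroid 3 (spanFamily b (fanoLines.erase L)) ((nonFanoLines_paving L).spanFamily b)

end

/-! A representation of a `q`-matroid over `𝔽_{q^m}` is an `𝔽_{q^m}`-linear code `D`, and the `i`-th
basis vector of the ground space acts on `D` as an `𝔽_{q^m}`-linear functional. These functionals
represent the induced matroid over `𝔽_{q^m}` as vectors in the dual of `D`, so that it suffices to
treat the classical matroids. The Vámos matroid violates Ingleton's inequality, and the non-Pappus
matroid contradicts Pappus' theorem. For the Fano and non-Fano matroids, let `a, b, c, d` be four
points in general position with diagonal points `p, q, r`. Then `[abc]² [pqr]` is `-2` times a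
product of nonzero brackets, so the diagonal points are collinear iff the characteristic is two. -/

open Module

/-! ### Vector representations of rank functions -/

attribute [ext] MatroidRank

namespace MatroidRank

variable {ι : Type*} [DecidableEq ι] {R : MatroidRank ι} {K : Type*} [Field K]
  {W W' : Type*} [AddCommGroup W] [Module K W] [AddCommGroup W'] [Module K W']

/-- The vectors `x i` of a `K`-space represent the rank function `R`: the rank of every set of
indices is the dimension of the span of the corresponding vectors. The ambient space `W` is
arbitrary, so that a representation can be moved along injective linear maps. -/
def IsRepresentedBy (R : MatroidRank ι) (K : Type*) [Field K] {W : Type*} [AddCommGroup W]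
    [Module K W] (x : ι → W) : Prop :=
  ∀ A : Finset ι, finrank K (Submodule.span K (x '' A)) = R.r A

theorem isRepresentedBy_comp_iff {f : W →ₗ[K] W'} (hf : Function.Injective f) {x : ι → W} :
    R.IsRepresentedBy K (f ∘ x) ↔ R.IsRepresentedBy K x := by
  refine forall_congr' fun A => ?_
  rw [Set.image_comp, ← Submodule.map_span, ← (Submodule.equivMapOfInjective f hf _).finrank_eq]

theorem isRepresentableOver_iff :
    R.toMatroid.IsRepresentableOver K ↔ ∃ (k : ℕ) (x : ι → Fin k → K), R.IsRepresentedBy K x := by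
  have cols_eq {k : ℕ} (G : Matrix (Fin k) ι K) (A : Finset ι) :
      (G.submatrix id (fun a : A => (a : ι))).rank =
        finrank K (Submodule.span K (G.col '' A)) := by
    rw [Matrix.rank_eq_finrank_span_cols, Set.image_eq_range]
    rfl
  simp only [Matroid.IsRepresentableOver, toMatroid_eRk, cols_eq, Nat.cast_inj, IsRepresentedBy]
  exact exists_congr fun k => ⟨fun ⟨G, hG⟩ => ⟨G.col, fun A => (hG A).symm⟩,
    fun ⟨x, hx⟩ => ⟨(Matrix.of x).transpose, fun A => (hx A).symm⟩⟩

theorem IsRepresentedBy.isRepresentableOver [FiniteDimensional K W] {x : ι → W}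
    (hx : R.IsRepresentedBy K x) : R.toMatroid.IsRepresentableOver K :=
  let e := (finBasis K W).equivFun
  isRepresentableOver_iff.2
    ⟨_, _, (isRepresentedBy_comp_iff (f := e.toLinearMap) e.injective).2 hx⟩

theorem IsRepresentedBy.exists_coordinates [Fintype ι] {k : ℕ} (hk : R.r Finset.univ = k)
    {x : ι → W} (hx : R.IsRepresentedBy K x) : ∃ y : ι → Fin k → K, R.IsRepresentedBy K y := by
  let S := Submodule.span K (Set.range x)
  have hS : finrank K S = k := by rw [← hk, ← hx, Finset.coe_univ, Set.image_univ]
  have : FiniteDimensional K S := FiniteDimensional.span_of_finite K (Set.finite_range x)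
  let x' : ι → S := fun i => ⟨x i, Submodule.subset_span ⟨i, rfl⟩⟩
  have hx' : R.IsRepresentedBy K x' := (isRepresentedBy_comp_iff S.injective_subtype).1 hx
  let e := LinearEquiv.ofFinrankEq S (Fin k → K) (by rw [hS, finrank_fin_fun])
  exact ⟨_, (isRepresentedBy_comp_iff (f := e.toLinearMap) e.injective).2 hx'⟩

end MatroidRank

theorem pavingRank_univ {ι : Type*} [DecidableEq ι] [Fintype ι] {k : ℕ} {𝒜 : Finset (Finset ι)}
    (h : IsPavingSets k 𝒜) (hk : k < Fintype.card ι) : (pavingRank h).r Finset.univ = k := by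
  have huniv : Finset.univ ∉ 𝒜 := fun hmem => hk.ne (h.card_eq _ hmem).symm
  exact (if_neg huniv).trans (min_eq_right hk.le)

/-! ### Ingleton's inequality and the Vámos matroid -/

theorem finrank_inf_add_finrank_inf_le {K W : Type*} [Field K] [AddCommGroup W] [Module K W]
    [FiniteDimensional K W] (A B C : Submodule K W) :
    finrank K ↥(A ⊓ C) + finrank K ↥(B ⊓ C) ≤
      finrank K ↥((A ⊔ B) ⊓ C) + finrank K ↥(A ⊓ B ⊓ C) := by
  have hsup : A ⊓ C ⊔ B ⊓ C ≤ (A ⊔ B) ⊓ C :=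
    sup_le (inf_le_inf_right C le_sup_left) (inf_le_inf_right C le_sup_right)
  calc finrank K ↥(A ⊓ C) + finrank K ↥(B ⊓ C)
    _ = finrank K ↥(A ⊓ C ⊔ B ⊓ C) + finrank K ↥(A ⊓ C ⊓ (B ⊓ C)) :=
      (Submodule.finrank_sup_add_finrank_inf_eq _ _).symm
    _ ≤ _ := by
      rw [inf_inf_distrib_right A B C]
      gcongr
      exact Submodule.finrank_mono hsup

theorem finrank_ingleton {K W : Type*} [Field K] [AddCommGroup W] [Module K W]
    [FiniteDimensional K W] (A B C D : Submodule K W) :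
    finrank K A + finrank K B + finrank K ↥(A ⊔ B ⊔ C) + finrank K ↥(A ⊔ B ⊔ D) +
        finrank K ↥(C ⊔ D) ≤
      finrank K ↥(A ⊔ B) + finrank K ↥(A ⊔ C) + finrank K ↥(A ⊔ D) + finrank K ↥(B ⊔ C) +
        finrank K ↥(B ⊔ D) := by
  have hABC := finrank_inf_add_finrank_inf_le A B C
  have hABD := finrank_inf_add_finrank_inf_le A B D
  have hCDAB : finrank K ↥(A ⊓ B ⊓ C) + finrank K ↥(A ⊓ B ⊓ D) ≤
      finrank K ↥(C ⊓ D) + finrank K ↥(A ⊓ B) := by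
    have h := finrank_inf_add_finrank_inf_le C D (A ⊓ B)
    rw [inf_comm C, inf_comm D] at h
    exact h.trans (by
      rw [add_comm]
      gcongr
      exacts [Submodule.finrank_mono inf_le_left, Submodule.finrank_mono inf_le_right])
  have modular := fun S T : Submodule K W => Submodule.finrank_sup_add_finrank_inf_eq S T
  have := modular A B
  have := modular A C
  have := modular A D
  have := modular B C
  have := modular B D
  have := modular C D
  have := modular (A ⊔ B) C
  have := modular (A ⊔ B) D
  omega

namespace MatroidRank

theorem IsRepresentedBy.ingleton {ι K W : Type*} [DecidableEq ι] {R : MatroidRank ι} [Field K]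
    [AddCommGroup W] [Module K W] [FiniteDimensional K W] {x : ι → W} (hx : R.IsRepresentedBy K x)
    (A B C D : Finset ι) :
    R.r A + R.r B + R.r (A ∪ B ∪ C) + R.r (A ∪ B ∪ D) + R.r (C ∪ D) ≤
      R.r (A ∪ B) + R.r (A ∪ C) + R.r (A ∪ D) + R.r (B ∪ C) + R.r (B ∪ D) := by
  let S := fun A : Finset ι => Submodule.span K (x '' A)
  have sup_eq (A B : Finset ι) : S A ⊔ S B = S (A ∪ B) := by
    simp only [S, ← Submodule.span_union, ← Set.image_union, ← Finset.coe_union]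
  have rank (A : Finset ι) : finrank K (S A) = R.r A := hx A
  have rank_sup (A B : Finset ι) : finrank K ↥(S A ⊔ S B) = R.r (A ∪ B) := by rw [sup_eq, rank]
  have h := finrank_ingleton (S A) (S B) (S C) (S D)
  rw [sup_eq A B] at h
  simpa only [rank_sup, rank] using h

end MatroidRank

set_option maxRecDepth 10000 in
theorem not_isRepresentableOver_vamosMatroid (K : Type*) [Field K] :
    ¬ vamosMatroid.IsRepresentableOver K := by
  intro hK
  obtain ⟨k, x, hx⟩ := MatroidRank.isRepresentableOver_iff.1 hK
  exact absurd (hx.ingleton {0, 3} {1, 2} {4, 5} {6, 7}) (by decide)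

/-! ### Pappus' theorem and the Fano configuration -/

/-- The bracket `[u v w]` of three vectors of `K³`. It vanishes iff the points of the projective
plane with these homogeneous coordinates are collinear. -/
def bracket {K : Type*} [CommRing K] (u v w : Fin 3 → K) : K :=
  (Matrix.of ![u, v, w]).det

section

variable {K : Type*} [CommRing K]

theorem bracket_eq (u v w : Fin 3 → K) :
    bracket u v w =
      u 0 * v 1 * w 2 - u 0 * v 2 * w 1 - u 1 * v 0 * w 2 + u 1 * v 2 * w 0 +
        u 2 * v 0 * w 1 - u 2 * v 1 * w 0 :=
  Matrix.det_fin_three _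

theorem bracket_mul_bracket_sub (u v x p q : Fin 3 → K) :
    bracket u x p * bracket x v q - bracket u x q * bracket x v p =
      bracket u x v * bracket x p q := by
  simp only [bracket_eq]
  ring

theorem bracket_mul_bracket_eq (u v : Fin 3 → K) {x p q : Fin 3 → K} (h : bracket x p q = 0) :
    bracket u x p * bracket x v q = bracket u x q * bracket x v p := by
  rw [← sub_eq_zero, bracket_mul_bracket_sub, h, mul_zero]

theorem bracket_eq_zero_of_mul_eq [IsDomain K] {u v x p q : Fin 3 → K} (hx : bracket u x v ≠ 0)
    (h : bracket u x p * bracket x v q = bracket u x q * bracket x v p) : bracket x p q = 0 := by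
  rw [← sub_eq_zero, bracket_mul_bracket_sub] at h
  exact (mul_eq_zero.1 h).resolve_left hx

theorem sq_bracket_mul_bracket (a b c p q r : Fin 3 → K) :
    bracket a b c ^ 2 * bracket p q r =
      bracket ![bracket b c p, bracket c a p, bracket a b p]
        ![bracket b c q, bracket c a q, bracket a b q]
        ![bracket b c r, bracket c a r, bracket a b r] := by
  simp only [bracket_eq, Matrix.cons_val]
  ring

theorem bracket_rotate (u v w : Fin 3 → K) : bracket u v w = bracket v w u := by
  simp only [bracket_eq]
  ring

theorem pappus [IsDomain K] {a₁ a₂ a₃ b₁ b₂ b₃ c₁ c₂ c₃ : Fin 3 → K}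
    (ha : bracket a₁ a₂ a₃ = 0) (hb : bracket b₁ b₂ b₃ = 0)
    (hab₁ : bracket c₁ a₂ b₃ = 0) (hba₁ : bracket c₁ a₃ b₂ = 0)
    (hab₂ : bracket a₁ b₃ c₂ = 0) (hba₂ : bracket b₁ a₃ c₂ = 0)
    (hab₃ : bracket a₁ b₂ c₃ = 0) (hba₃ : bracket b₁ a₂ c₃ = 0)
    (ha₂ : bracket a₁ b₁ a₂ ≠ 0) (ha₃ : bracket a₁ b₁ a₃ ≠ 0) (hb₂ : bracket a₁ b₁ b₂ ≠ 0)
    (hb₃ : bracket a₁ b₁ b₃ ≠ 0) (hc₁ : bracket a₁ b₁ c₁ ≠ 0) :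
    bracket c₁ c₂ c₃ = 0 := by
  -- Up to scalars, `x, y, z` are homogeneous coordinates for the triangle of reference `a₁ b₁ c₁`.
  let x := bracket b₁ c₁
  let y := bracket c₁ a₁
  let z := bracket a₁ b₁
  have h_a₁ {p q} (h : bracket a₁ p q = 0) : y p * z q = y q * z p :=
    bracket_mul_bracket_eq c₁ b₁ h
  have h_b₁ {p q} (h : bracket b₁ p q = 0) : z p * x q = z q * x p :=
    bracket_mul_bracket_eq a₁ c₁ h
  have h_c₁ {p q} (h : bracket c₁ p q = 0) : x p * y q = x q * y p :=
    bracket_mul_bracket_eq b₁ a₁ h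
  have exchange : x a₃ * y b₂ * (z a₂ * z b₃) = x a₂ * y b₃ * (z a₃ * z b₂) :=
    calc x a₃ * y b₂ * (z a₂ * z b₃)
      _ = z b₃ * x b₂ * (y a₃ * z a₂) := by rw [h_c₁ hba₁]; ring
      _ = z b₂ * x b₃ * (y a₂ * z a₃) := by rw [h_a₁ ha, h_b₁ hb]
      _ = x a₂ * y b₃ * (z a₃ * z b₂) := by rw [h_c₁ hab₁]; ring
  have collinear : x c₂ * y c₃ = x c₃ * y c₂ := by
    have hz : z a₂ * z a₃ * z b₂ * z b₃ ≠ 0 :=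
      mul_ne_zero (mul_ne_zero (mul_ne_zero ha₂ ha₃) hb₂) hb₃
    refine mul_left_cancel₀ hz ?_
    calc z a₂ * z a₃ * z b₂ * z b₃ * (x c₂ * y c₃)
      _ = z a₃ * x c₂ * (y c₃ * z b₂) * (z a₂ * z b₃) := by ring
      _ = z c₂ * z c₃ * (x a₃ * y b₂ * (z a₂ * z b₃)) := by
        rw [h_b₁ hba₂, ← h_a₁ hab₃]; ring
      _ = z c₂ * z c₃ * (x a₂ * y b₃ * (z a₃ * z b₂)) := by rw [exchange]
      _ = z a₂ * x c₃ * (y c₂ * z b₃) * (z a₃ * z b₂) := by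
        rw [h_b₁ hba₃, ← h_a₁ hab₂]; ring
      _ = z a₂ * z a₃ * z b₂ * z b₃ * (x c₃ * y c₂) := by ring
  exact bracket_eq_zero_of_mul_eq (by rwa [← bracket_rotate]) collinear

theorem sq_bracket_mul_bracket_diagonal_points [IsDomain K] {a b c d p q r : Fin 3 → K}
    (hab : bracket a b p = 0) (hcd : bracket c p d = 0) (hca : bracket c a q = 0)
    (hbd : bracket b q d = 0) (hbc : bracket b c r = 0) (had : bracket a r d = 0)
    (hx : bracket b c d ≠ 0) (hy : bracket c a d ≠ 0) (hz : bracket a b d ≠ 0) :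
    bracket a b c ^ 2 * bracket p q r =
      -2 * (bracket b c p * bracket a b q * bracket c a r) := by
  let x := bracket b c
  let y := bracket c a
  let z := bracket a b
  have h_a : y r * z d = y d * z r := bracket_mul_bracket_eq c b had
  have h_b : z q * x d = z d * x q := bracket_mul_bracket_eq a c hbd
  have h_c : x p * y d = x d * y p := bracket_mul_bracket_eq b a hcd
  have ceva : x p * z q * y r = y p * x q * z r := by
    refine mul_left_cancel₀ (mul_ne_zero (mul_ne_zero hx hy) hz) ?_
    calc x d * y d * z d * (x p * z q * y r)
      _ = x p * y d * (z q * x d) * (y r * z d) := by ring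
      _ = x d * y p * (z d * x q) * (y d * z r) := by rw [h_a, h_b, h_c]
      _ = x d * y d * z d * (y p * x q * z r) := by ring
  rw [sq_bracket_mul_bracket, hab, hca, hbc, bracket_eq]
  simp only [Matrix.cons_val]
  linear_combination ceva

end

namespace MatroidRank

variable {ι : Type*} [DecidableEq ι] {R : MatroidRank ι} {K : Type*} [Field K]

theorem IsRepresentedBy.linearIndependent_comp_iff {W κ : Type*} [AddCommGroup W] [Module K W]
    [Fintype κ] {x : ι → W} (hx : R.IsRepresentedBy K x) (s : κ → ι) :
    LinearIndependent K (x ∘ s) ↔ R.r (Finset.univ.image s) = Fintype.card κ := by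
  rw [linearIndependent_iff_card_eq_finrank_span, ← hx, Finset.coe_image, Finset.coe_univ,
    Set.image_univ, ← Set.range_comp, Set.finrank, eq_comm]

theorem IsRepresentedBy.bracket_eq_zero_iff {y : ι → Fin 3 → K} (hy : R.IsRepresentedBy K y)
    (i j l : ι) : bracket (y i) (y j) (y l) = 0 ↔ R.r {i, j, l} ≠ 3 := by
  have himage : Finset.univ.image ![i, j, l] = {i, j, l} := by
    ext; simp [Fin.exists_fin_succ, eq_comm]
  have hrows : (Matrix.of ![y i, y j, y l]).row = y ∘ ![i, j, l] := by
    ext a : 1; fin_cases a <;> rfl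
  rw [← not_iff_not, not_not, ← himage, ← Fintype.card_fin 3, ← hy.linearIndependent_comp_iff,
    ← hrows, Matrix.linearIndependent_rows_iff_isUnit, Matrix.isUnit_iff_isUnit_det,
    isUnit_iff_ne_zero]
  rfl

/-- The points `a, b, c, d` of a rank function of rank `3` are in general position, and `p, q, r`
are the diagonal points of this quadrangle: `p` lies on `ab` and `cd`, `q` on `ca` and `bd`, and
`r` on `bc` and `ad`. The conditions on `bcp`, `abq` and `car` say that none of `p, q, r` is a
loop. -/
structure IsQuadrangle (R : MatroidRank ι) (a b c d p q r : ι) : Prop where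
  indep_abc : R.r {a, b, c} = 3
  indep_bcd : R.r {b, c, d} = 3
  indep_cad : R.r {c, a, d} = 3
  indep_abd : R.r {a, b, d} = 3
  indep_bcp : R.r {b, c, p} = 3
  indep_abq : R.r {a, b, q} = 3
  indep_car : R.r {c, a, r} = 3
  dep_abp : R.r {a, b, p} ≠ 3
  dep_cpd : R.r {c, p, d} ≠ 3
  dep_caq : R.r {c, a, q} ≠ 3
  dep_bqd : R.r {b, q, d} ≠ 3
  dep_bcr : R.r {b, c, r} ≠ 3
  dep_ard : R.r {a, r, d} ≠ 3

theorem IsQuadrangle.r_diagonal_ne_three_iff {y : ι → Fin 3 → K} (hy : R.IsRepresentedBy K y)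
    {a b c d p q r : ι} (h : R.IsQuadrangle a b c d p q r) :
    R.r {p, q, r} ≠ 3 ↔ (2 : K) = 0 := by
  have collinear {i j l : ι} : R.r {i, j, l} ≠ 3 → bracket (y i) (y j) (y l) = 0 :=
    (hy.bracket_eq_zero_iff i j l).2
  have noncollinear {i j l : ι} (hr : R.r {i, j, l} = 3) : bracket (y i) (y j) (y l) ≠ 0 :=
    fun h0 => (hy.bracket_eq_zero_iff i j l).1 h0 hr
  have key := sq_bracket_mul_bracket_diagonal_points (collinear h.dep_abp) (collinear h.dep_cpd)
    (collinear h.dep_caq) (collinear h.dep_bqd) (collinear h.dep_bcr) (collinear h.dep_ard)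
    (noncollinear h.indep_bcd) (noncollinear h.indep_cad) (noncollinear h.indep_abd)
  rw [← hy.bracket_eq_zero_iff,
    ← mul_eq_zero_iff_left (pow_ne_zero 2 (noncollinear h.indep_abc)), key,
    mul_eq_zero_iff_right (mul_ne_zero (mul_ne_zero (noncollinear h.indep_bcp)
      (noncollinear h.indep_abq)) (noncollinear h.indep_car)), neg_eq_zero]

end MatroidRank

set_option maxRecDepth 10000 in
theorem not_isRepresentableOver_nonPappusMatroid (K : Type*) [Field K] :
    ¬ nonPappusMatroid.IsRepresentableOver K := by
  intro hK
  obtain ⟨k, x, hx⟩ := MatroidRank.isRepresentableOver_iff.1 hK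
  obtain ⟨y, hy⟩ := hx.exists_coordinates (pavingRank_univ nonPappusLines_paving (by decide))
  have hbracket := hy.bracket_eq_zero_iff
  have collinear : bracket (y 8) (y 7) (y 6) = 0 := by
    apply pappus (a₁ := y 0) (a₂ := y 1) (a₃ := y 2) (b₁ := y 3) (b₂ := y 4) (b₃ := y 5) <;>
      simp only [ne_eq, hbracket] <;> decide
  exact (hbracket 8 7 6).1 collinear (by decide)

theorem fanoLines_isQuadrangle : (pavingRank fanoLines_paving).IsQuadrangle 0 1 2 6 3 5 4 := by
  constructor <;> decide

set_option maxRecDepth 10000 in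
theorem exists_isQuadrangle_nonFanoLines {L : Finset (Fin 7)} (hL : L ∈ fanoLines) :
    ∃ a b c d p q r, L = {p, q, r} ∧
      (pavingRank (nonFanoLines_paving L)).IsQuadrangle a b c d p q r := by
  simp only [fanoLines, Finset.mem_insert, Finset.mem_singleton] at hL
  -- In the Fano plane, the points off a line form a quadrangle with diagonal points on that line.
  rcases hL with rfl | rfl | rfl | rfl | rfl | rfl | rfl
  · exact ⟨2, 5, 4, 6, 0, 1, 3, rfl, by constructor <;> decide⟩
  · exact ⟨0, 3, 5, 6, 1, 2, 4, rfl, by constructor <;> decide⟩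
  · exact ⟨0, 5, 1, 4, 2, 3, 6, rfl, by constructor <;> decide⟩
  · exact ⟨1, 3, 2, 5, 0, 4, 6, rfl, by constructor <;> decide⟩
  · exact ⟨0, 3, 2, 4, 1, 5, 6, rfl, by constructor <;> decide⟩
  · exact ⟨0, 1, 6, 2, 3, 4, 5, rfl, by constructor <;> decide⟩
  · exact ⟨1, 3, 4, 6, 0, 2, 5, rfl, by constructor <;> decide⟩

theorem not_isRepresentableOver_fanoMatroid {K : Type*} [Field K] (hK : (2 : K) ≠ 0) :
    ¬ fanoMatroid.IsRepresentableOver K := by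
  intro hrep
  obtain ⟨k, x, hx⟩ := MatroidRank.isRepresentableOver_iff.1 hrep
  obtain ⟨y, hy⟩ := hx.exists_coordinates (pavingRank_univ fanoLines_paving (by decide))
  exact hK ((fanoLines_isQuadrangle.r_diagonal_ne_three_iff hy).1 (by decide))

theorem not_isRepresentableOver_nonFanoMatroid {L : Finset (Fin 7)} (hL : L ∈ fanoLines)
    {K : Type*} [Field K] (hK : (2 : K) = 0) :
    ¬ (nonFanoMatroid L).IsRepresentableOver K := by
  intro hrep
  obtain ⟨k, x, hx⟩ := MatroidRank.isRepresentableOver_iff.1 hrep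
  obtain ⟨y, hy⟩ := hx.exists_coordinates (pavingRank_univ (nonFanoLines_paving L) (by decide))
  obtain ⟨a, b, c, d, p, q, r, rfl, hquad⟩ := exists_isQuadrangle_nonFanoLines hL
  refine (hquad.r_diagonal_ne_three_iff hy).2 hK ?_
  have hcard := fanoLines_paving.card_eq _ hL
  simp [pavingRank, hcard]

/-! ### Codes that are linear over an extension field -/

section ExtensionFields

variable {F K : Type*} [Field F] [Field K] [Algebra F K]

theorem adjoin_eq_top_of_forall_mem_zpowers [Algebra.IsAlgebraic F K] {ω : Kˣ}
    (hω : ∀ x : Kˣ, x ∈ Subgroup.zpowers ω) : Algebra.adjoin F {(ω : K)} = ⊤ := by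
  rw [← IntermediateField.adjoin_simple_toSubalgebra_of_isAlgebraic
    (Algebra.IsAlgebraic.isAlgebraic _), eq_top_iff]
  rintro x -
  obtain rfl | hx := eq_or_ne x 0
  · exact zero_mem _
  obtain ⟨z, hz : ω ^ z = Units.mk0 x hx⟩ := hω (Units.mk0 x hx)
  rw [← Units.val_mk0 hx, ← hz, Units.val_zpow_eq_zpow_val]
  exact zpow_mem (IntermediateField.mem_adjoin_simple_self F _) z

theorem companionMatrix_powerBasis (pb : PowerBasis F K) :
    companionMatrix pb.dim (minpoly F pb.gen) =
      (Algebra.leftMulMatrix pb.basis pb.gen).transpose := by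
  rw [pb.leftMulMatrix, pb.minpolyGen_eq]
  rfl

theorem equivFun_symm_vecMul_companionMatrix (pb : PowerBasis F K) (v : Fin pb.dim → F) :
    pb.basis.equivFun.symm (Matrix.vecMul v (companionMatrix pb.dim (minpoly F pb.gen))) =
      pb.gen * pb.basis.equivFun.symm v := by
  rw [LinearEquiv.symm_apply_eq, companionMatrix_powerBasis, Matrix.vecMul_transpose,
    Basis.equivFun_apply, ← Algebra.leftMulMatrix_mulVec_repr, ← Basis.equivFun_apply,
    LinearEquiv.apply_symm_apply]

theorem exists_linearEquiv_vecMul_companionMatrix [FiniteDimensional F K] {ω : K}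
    (hω : Algebra.adjoin F {ω} = ⊤) :
    ∃ e : (Fin (finrank F K) → F) ≃ₗ[F] K, ∀ v,
      e (Matrix.vecMul v (companionMatrix (finrank F K) (minpoly F ω))) = ω * e v := by
  let pb := PowerBasis.ofAdjoinEqTop (Algebra.IsIntegral.isIntegral (R := F) ω) hω
  have hgen : pb.gen = ω := PowerBasis.ofAdjoinEqTop_gen _ _
  rw [pb.finrank, ← hgen]
  exact ⟨pb.basis.equivFun.symm, equivFun_symm_vecMul_companionMatrix pb⟩

theorem smul_mem_of_adjoin_eq_top {W : Type*} [AddCommGroup W] [Module K W] [Module F W]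
    [IsScalarTower F K W] {ω : K} (hω : Algebra.adjoin F {ω} = ⊤) {S : Submodule F W}
    (hS : ∀ w ∈ S, ω • w ∈ S) (a : K) {w : W} (hw : w ∈ S) : a • w ∈ S := by
  have ha : a ∈ Algebra.adjoin F {ω} := hω ▸ Algebra.mem_top
  induction ha using Algebra.adjoin_induction generalizing w with
  | mem x hx => rw [Set.mem_singleton_iff.1 hx]; exact hS w hw
  | algebraMap r => rw [algebraMap_smul]; exact S.smul_mem r hw
  | add x y _ _ hx hy => rw [add_smul]; exact S.add_mem (hx hw) (hy hw)
  | mul x y _ _ hx hy => rw [mul_smul]; exact hx (hy hw)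

/-- Applying `e` to every row identifies the `n × m` matrices over `F` with the vectors of length
`n` over an extension field of degree `m`. -/
noncomputable def rowEquiv {n m : ℕ} (e : (Fin m → F) ≃ₗ[F] K) :
    Matrix (Fin n) (Fin m) F ≃ₗ[F] (Fin n → K) :=
  LinearEquiv.piCongrRight fun _ => e

theorem IsRightLinear.exists_submodule [FiniteDimensional F K] {n : ℕ}
    {C : Submodule F (Matrix (Fin n) (Fin (finrank F K)) F)} (hC : IsRightLinear K C) :
    ∃ (e : (Fin (finrank F K) → F) ≃ₗ[F] K) (D : Submodule K (Fin n → K)),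
      D.restrictScalars F = C.map (rowEquiv e).toLinearMap := by
  obtain ⟨ω, hω, X, hX⟩ := hC
  have htop : Algebra.adjoin F {(ω : K)} = ⊤ := adjoin_eq_top_of_forall_mem_zpowers hω
  obtain ⟨e₀, he₀⟩ := exists_linearEquiv_vecMul_companionMatrix htop
  let X' : (Fin (finrank F K) → F) ≃ₗ[F] (Fin (finrank F K) → F) :=
    Matrix.toLinearEquivRight'OfInv X.inv_mul X.mul_inv
  let e := X'.trans e₀
  have hrow (M : Matrix (Fin n) (Fin (finrank F K)) F) :
      rowEquiv e M = rowEquiv e₀ (M * X.val) := rfl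
  have hmul (M : Matrix (Fin n) (Fin (finrank F K)) F) :
      rowEquiv e₀ (M * companionMatrix (finrank F K) (minpoly F (ω : K))) =
        (ω : K) • rowEquiv e₀ M :=
    funext fun i => he₀ (M i)
  have hstable : ∀ c ∈ C.map (rowEquiv e).toLinearMap,
      (ω : K) • c ∈ C.map (rowEquiv e).toLinearMap := by
    rintro _ ⟨M, hM, rfl⟩
    obtain ⟨N, hN, hMN⟩ := hX M hM
    refine ⟨N, hN, ?_⟩
    rw [LinearEquiv.coe_coe, hrow, hrow, ← hMN, hmul]
  exact ⟨e, { C.map (rowEquiv e).toLinearMap with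
    smul_mem' := fun a c hc => smul_mem_of_adjoin_eq_top htop hstable a hc }, rfl⟩

end ExtensionFields

/-! ### Representations of `q`-polymatroids -/

section

variable {F K : Type*} [Field F] [Field K]

/-- The `F`-linear map `g` into a `K`-space represents the `q`-polymatroid `M`: the rank of every
subspace is the `K`-dimension of the `K`-span of its image. -/
def QPolymatroid.IsRepresentedBy {E : Type*} [AddCommGroup E] [Module F E] (M : QPolymatroid F E)
    (K : Type*) [Field K] {W : Type*} [AddCommGroup W] [Module K W] [Module F W]
    (g : E →ₗ[F] W) : Prop :=
  ∀ V : Submodule F E, M.rk V = finrank K (Submodule.span K (g '' V))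

theorem QPolymatroid.IsRepresentedBy.of_equivalent {E₁ E₂ W : Type*} [AddCommGroup E₁]
    [Module F E₁] [AddCommGroup E₂] [Module F E₂] [AddCommGroup W] [Module K W] [Module F W]
    {M₁ : QPolymatroid F E₁} {M₂ : QPolymatroid F E₂} {g : E₂ →ₗ[F] W}
    (hg : M₂.IsRepresentedBy K g) {α : E₁ ≃ₗ[F] E₂}
    (hα : ∀ V : Submodule F E₁, M₂.rk (V.map (α : E₁ →ₗ[F] E₂)) = M₁.rk V) :
    M₁.IsRepresentedBy K (g ∘ₗ α.toLinearMap) := by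
  intro V
  rw [← hα, hg, Submodule.map_coe, Set.image_image]
  rfl

variable [Algebra F K]

theorem finrank_eq_mul_of_restrictScalars_eq_map {V W : Type*} [AddCommGroup V] [Module F V]
    [AddCommGroup W] [Module F W] [Module K W] [IsScalarTower F K W] (e : V ≃ₗ[F] W)
    {A : Submodule F V} {B : Submodule K W} (h : B.restrictScalars F = A.map e.toLinearMap) :
    finrank F A = finrank F K * finrank K B :=
  calc finrank F A
    _ = finrank F (A.map e.toLinearMap) := (e.finrank_map_eq A).symm
    _ = finrank F (B.restrictScalars F) := by rw [h]
    _ = finrank F K * finrank K B := (finrank_mul_finrank F K B).symm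

variable {n : ℕ}

/-- The map `v ↦ ∑ i, v i • cᵢ` into the dual of the code `D`, where `cᵢ` is the `i`-th coordinate
functional. The vectors `cᵢ` are the columns of a generator matrix of `D`, up to a choice of
basis. -/
noncomputable def dualGeneratorMap (F : Type*) [Field F] [Algebra F K]
    (D : Submodule K (Fin n → K)) : (Fin n → F) →ₗ[F] Dual K D :=
  Fintype.linearCombination F fun i => (LinearMap.proj i).comp D.subtype

theorem dualGeneratorMap_apply (D : Submodule K (Fin n → K)) (v : Fin n → F) (d : D) :
    dualGeneratorMap F D v d = ∑ i, v i • (d : Fin n → K) i := by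
  simp [dualGeneratorMap, Fintype.linearCombination_apply]

theorem dualGeneratorMap_rowEquiv {m : ℕ} {e : (Fin m → F) ≃ₗ[F] K} {D : Submodule K (Fin n → K)}
    {M : Matrix (Fin n) (Fin m) F} (hM : rowEquiv e M ∈ D) (v : Fin n → F) :
    dualGeneratorMap F D v ⟨rowEquiv e M, hM⟩ = e (Matrix.vecMul v M) := by
  rw [dualGeneratorMap_apply, Matrix.vecMul_eq_sum, map_sum]
  simp only [map_smul]
  rfl

theorem restrictScalars_map_dualCoannihilator {m : ℕ}
    {C : Submodule F (Matrix (Fin n) (Fin m) F)} {e : (Fin m → F) ≃ₗ[F] K}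
    {D : Submodule K (Fin n → K)} (hD : D.restrictScalars F = C.map (rowEquiv e).toLinearMap)
    (V : Submodule F (Fin n → F)) :
    ((Submodule.span K (dualGeneratorMap F D '' V)).dualCoannihilator.map
      D.subtype).restrictScalars F = (shortening C (dotPerp V)).map (rowEquiv e).toLinearMap := by
  have hmem_map (M) (A : Submodule F (Matrix (Fin n) (Fin m) F)) :
      rowEquiv e M ∈ A.map (rowEquiv e).toLinearMap ↔ M ∈ A := by
    rw [Submodule.mem_map_equiv, LinearEquiv.symm_apply_apply]
  have hmem (M) : rowEquiv e M ∈ D ↔ M ∈ C := by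
    rw [← Submodule.restrictScalars_mem F, hD, hmem_map]
  have hcoann (d : D) : d ∈ (Submodule.span K (dualGeneratorMap F D '' V)).dualCoannihilator ↔
      ∀ v ∈ V, dualGeneratorMap F D v d = 0 := by
    rw [← SetLike.mem_coe, Submodule.coe_dualCoannihilator_span, Set.mem_ofPred_eq,
      Set.forall_mem_image]
    rfl
  ext c
  obtain ⟨M, rfl⟩ := (rowEquiv e).surjective c
  simp only [Submodule.restrictScalars_mem, hmem_map, mem_shortening_perp, Submodule.mem_map,
    Submodule.subtype_apply, Subtype.exists, exists_and_right, exists_eq_right, hcoann,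
    dualGeneratorMap_rowEquiv, EmbeddingLike.map_eq_zero_iff, exists_prop, hmem]

theorem columnQPM_isRepresentedBy [FiniteDimensional F K]
    {C : Submodule F (Matrix (Fin n) (Fin (finrank F K)) F)}
    {e : (Fin (finrank F K) → F) ≃ₗ[F] K} {D : Submodule K (Fin n → K)}
    (hD : D.restrictScalars F = C.map (rowEquiv e).toLinearMap) :
    (columnQPM C).IsRepresentedBy K (dualGeneratorMap F D) := by
  intro V
  let S := Submodule.span K (dualGeneratorMap F D '' V)
  have hC : finrank F C = finrank F K * finrank K D :=
    finrank_eq_mul_of_restrictScalars_eq_map (rowEquiv e) hD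
  have hshort : finrank F (shortening C (dotPerp V)) =
      finrank F K * finrank K S.dualCoannihilator := by
    rw [finrank_eq_mul_of_restrictScalars_eq_map (rowEquiv e)
        (restrictScalars_map_dualCoannihilator hD V), Submodule.finrank_map_subtype_eq]
  have hdual : finrank K S + finrank K S.dualCoannihilator = finrank K D :=
    Subspace.finrank_add_finrank_dualCoannihilator_eq S
  have hm : (finrank F K : ℚ) ≠ 0 := Nat.cast_ne_zero.2 finrank_pos.ne'
  change ((finrank F C : ℚ) - finrank F (shortening C (dotPerp V))) / finrank F K = finrank K S
  rw [div_eq_iff hm, hC, hshort, ← hdual]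
  push_cast
  ring

theorem QMatroid.inducedRank_isRepresentedBy {E ι W : Type*} [AddCommGroup E] [Module F E]
    [DecidableEq ι] [AddCommGroup W] [Module K W] [Module F W] [IsScalarTower F K W]
    {M : QMatroid F E} {g : E →ₗ[F] W} (hg : M.toQPolymatroid.IsRepresentedBy K g)
    (b : Basis ι F E) : (M.inducedRank b).IsRepresentedBy K (g ∘ b) := by
  intro A
  change _ = ⌊M.rk (Submodule.span F (b '' A))⌋₊
  rw [hg, Nat.floor_natCast, ← Submodule.map_coe, Submodule.map_span,
    Submodule.span_span_of_tower, Set.image_comp]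

theorem QMatroid.IsRepresentableOver.inducedMatroid [FiniteDimensional F K] {E ι : Type*}
    [AddCommGroup E] [Module F E] [DecidableEq ι] {M : QMatroid F E}
    (hM : M.IsRepresentableOver K) (b : Basis ι F E) :
    (M.inducedMatroid b).IsRepresentableOver K := by
  obtain ⟨n, C, hC, α, hα⟩ := hM
  obtain ⟨e, D, hD⟩ := hC.exists_submodule
  exact (QMatroid.inducedRank_isRepresentedBy ((columnQPM_isRepresentedBy hD).of_equivalent hα)
    b).isRepresentableOver

end

/-! ### Paving `q`-matroids -/

section

variable {F E ι : Type*} [Field F] [AddCommGroup E] [Module F E]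

theorem span_mem_spanFamily_iff (b : Basis ι F E) (𝒜 : Finset (Finset ι)) (A : Finset ι) :
    Submodule.span F (b '' A) ∈ spanFamily b 𝒜 ↔ A ∈ 𝒜 := by
  refine ⟨?_, fun hA => ⟨A, hA, rfl⟩⟩
  rintro ⟨B, hB, hAB⟩
  have : A = B := by
    ext i
    rw [← Finset.mem_coe, ← b.self_mem_span_image (R := F), hAB, b.self_mem_span_image,
      Finset.mem_coe]
  rwa [this]

variable [FiniteDimensional F E] [DecidableEq ι] {k : ℕ} {𝒜 : Finset (Finset ι)}

theorem inducedMatroid_pavingQMatroid (b : Basis ι F E) (h : IsPavingSets k 𝒜) :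
    (pavingQMatroid k (spanFamily b 𝒜) (h.spanFamily b)).inducedMatroid b =
      pavingMatroid k 𝒜 h := by
  refine congrArg MatroidRank.toMatroid (MatroidRank.ext (funext fun A => ?_))
  change ⌊(qPavingRank k (spanFamily b 𝒜) (Submodule.span F (b '' A)) : ℚ)⌋₊ =
    if A ∈ 𝒜 then k - 1 else min A.card k
  simp only [Nat.floor_natCast, qPavingRank, span_mem_spanFamily_iff, finrank_span_basis]

theorem not_isRepresentableOver_pavingQMatroid (b : Basis ι F E) (h : IsPavingSets k 𝒜)
    {K : Type*} [Field K] [Algebra F K] [FiniteDimensional F K]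
    (hK : ¬ (pavingMatroid k 𝒜 h).IsRepresentableOver K) :
    ¬ (pavingQMatroid k (spanFamily b 𝒜) (h.spanFamily b)).IsRepresentableOver K := fun hrep =>
  hK (inducedMatroid_pavingQMatroid b h ▸ hrep.inducedMatroid b)

end

theorem two_eq_zero_iff_ringChar_eq_two (R : Type*) [NonAssocSemiring R] [Nontrivial R] :
    (2 : R) = 0 ↔ ringChar R = 2 := by
  rw [← Nat.cast_ofNat, ringChar.spec, Nat.dvd_prime Nat.prime_two,
    or_iff_right CharP.ringChar_ne_one]

theorem two_eq_zero_iff_even_natCard (F K : Type*) [Field F] [Finite F] [Field K] [Algebra F K] :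
    (2 : K) = 0 ↔ Even (Nat.card F) := by
  have := Fintype.ofFinite F
  rw [two_eq_zero_iff_ringChar_eq_two, ← Algebra.ringChar_eq F K,
    FiniteField.even_card_iff_char_two, Nat.even_iff, Nat.card_eq_fintype_card]

theorem mainTheorem3 {F : Type u} [Field F] [Finite F] :
    -- the Vámos matroid, any `q`
    ((∀ (K : Type v) [Field K], ¬ vamosMatroid.IsRepresentableOver K) ∧
      ∀ b : Module.Basis (Fin 8) F (Fin 8 → F),
        (vamosQMatroid b).inducedMatroid b = vamosMatroid ∧
          ∀ (K : Type w) [Field K] [Algebra F K] [FiniteDimensional F K],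
            ¬ (vamosQMatroid b).IsRepresentableOver K) ∧
    -- the non-Pappus matroid, any `q`
    ((∀ (K : Type v) [Field K], ¬ nonPappusMatroid.IsRepresentableOver K) ∧
      ∀ b : Module.Basis (Fin 9) F (Fin 9 → F),
        (nonPappusQMatroid b).inducedMatroid b = nonPappusMatroid ∧
          ∀ (K : Type w) [Field K] [Algebra F K] [FiniteDimensional F K],
            ¬ (nonPappusQMatroid b).IsRepresentableOver K) ∧
    -- the Fano matroid, `q` odd
    ((∀ (K : Type v) [Field K], Odd (ringChar K) →
        ¬ fanoMatroid.IsRepresentableOver K) ∧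
      ∀ b : Module.Basis (Fin 7) F (Fin 7 → F),
        (fanoQMatroid b).inducedMatroid b = fanoMatroid ∧
          (Odd (Nat.card F) →
            ∀ (K : Type w) [Field K] [Algebra F K] [FiniteDimensional F K],
              ¬ (fanoQMatroid b).IsRepresentableOver K)) ∧
    -- the non-Fano matroid (any one of the seven lines omitted), `q` even
    (∀ L ∈ fanoLines,
      (∀ (K : Type v) [Field K], ringChar K = 2 →
        ¬ (nonFanoMatroid L).IsRepresentableOver K) ∧
      ∀ b : Module.Basis (Fin 7) F (Fin 7 → F),
        (nonFanoQMatroid L b).inducedMatroid b = nonFanoMatroid L ∧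
          (Even (Nat.card F) →
            ∀ (K : Type w) [Field K] [Algebra F K] [FiniteDimensional F K],
              ¬ (nonFanoQMatroid L b).IsRepresentableOver K)) ∧
    -- over every finite field, some `q`-matroid is not representable over any `F_{q^m}`
    (∃ (n : ℕ) (M : QMatroid F (Fin n → F)),
      ∀ (K : Type w) [Field K] [Algebra F K] [FiniteDimensional F K],
        ¬ M.IsRepresentableOver K) := by
  have hvamos (b : Basis (Fin 8) F (Fin 8 → F)) (K : Type w) [Field K] [Algebra F K]
      [FiniteDimensional F K] : ¬ (vamosQMatroid b).IsRepresentableOver K :=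
    not_isRepresentableOver_pavingQMatroid b _ (not_isRepresentableOver_vamosMatroid K)
  refine ⟨⟨fun K _ => not_isRepresentableOver_vamosMatroid K,
      fun b => ⟨inducedMatroid_pavingQMatroid b _, hvamos b⟩⟩,
    ⟨fun K _ => not_isRepresentableOver_nonPappusMatroid K,
      fun b => ⟨inducedMatroid_pavingQMatroid b _, fun K _ _ _ =>
        not_isRepresentableOver_pavingQMatroid b _ (not_isRepresentableOver_nonPappusMatroid K)⟩⟩,
    ⟨fun K _ hK => not_isRepresentableOver_fanoMatroid fun h2 => ?_,
      fun b => ⟨inducedMatroid_pavingQMatroid b _, fun hF K _ _ _ =>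
        not_isRepresentableOver_pavingQMatroid b _ (not_isRepresentableOver_fanoMatroid ?_)⟩⟩,
    fun L hL => ⟨fun K _ hK => not_isRepresentableOver_nonFanoMatroid hL
        ((two_eq_zero_iff_ringChar_eq_two K).2 hK),
      fun b => ⟨inducedMatroid_pavingQMatroid b _, fun hF K _ _ _ =>
        not_isRepresentableOver_pavingQMatroid b _ (not_isRepresentableOver_nonFanoMatroid hL
          ((two_eq_zero_iff_even_natCard F K).2 hF))⟩⟩,
    ⟨8, vamosQMatroid (Pi.basisFun F (Fin 8)), hvamos _⟩⟩
  · rw [(two_eq_zero_iff_ringChar_eq_two K).1 h2] at hK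
    exact absurd hK (by decide)
  · rwa [ne_eq, two_eq_zero_iff_even_natCard F, Nat.not_even_iff_odd]
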